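/- **Setting.** Let $p,q\in[0,1]$ and $\beta\ge 0$, and put $a=2p-1$. Say that $\xi$ has law $\mathcal R(r)$ if $\mathbb P(\xi=1)=r=1-\mathbb P(\xi=-1)$. The amnesic elephant random walk (AERW) is defined by $S_0=0$ and $S_n=X_1+\dots+X_n$, where $X_1\sim\mathcal R(q)$ and, for every $n\ge1$, $$X_{n+1}=\alpha_{n+1}X_{\beta_{n+1}}\quad\text{a.s.},\qquad \alpha_{n+1}\sim\mathcal R(p),\qquad \mathbb P(\beta_{n+1}=k)=\frac{(\beta+1)\,\Gamma(k+\beta)\,\Gamma(n)}{\Gamma(k)\,\Gamma(n+\beta+1)}\quad(1\le k\le n),$$ with $\alpha_{n+1}$ and $\beta_{n+1}$ independent of each other and, jointly, of the past $(X_1,\dots,X_n)$. **Theorem 2.7.** Suppose that $p>\dfrac{4\beta+3}{4(\beta+1)}$ (the superdiffusive regime), and let $S_n$ be the AERW. Then there is a square-integrable random variable $L_\beta$, defined on the same probability space, such that $$\lim_{n\to\infty}\frac{S_n}{n^{a(\beta+1)-\beta}}=L_\beta\quad\text{a.s.},\qquad \lim_{n\to\infty}\mathbb E\left[\left|\frac{S_n}{n^{a(\beta+1)-\beta}}-L_\beta\right|^2\right]=0,$$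 and, in distribution in the space $D([0,\infty))$ of real càdlàg functions with the Skorokhod ($J_1$) topology, $$\left(\frac{S_{\lfloor nt\rfloor}}{n^{a(\beta+1)-\beta}},\ t\ge0\right)\Longrightarrow\left(t^{a(\beta+1)-\beta}L_\beta,\ t\ge0\right)\qquad(n\to\infty).$$ Moreover $L_\beta$ is non-degenerate (not almost surely equal to a constant), except in the trivial case $p=1$, $q\in\{0,1\}$, in which the walk is deterministic. -/

import Mathlib

open MeasureTheory ProbabilityTheory Filter Topology Set
open scoped NNReal

/-- A function on `[0, ∞)` is càdlàg if it is right-continuous and has a (finite) left limit at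
every point (at `t = 0` the condition on left limits is void). -/
structure IsCadlag (f : ℝ≥0 → ℝ) : Prop where
  right_continuous : ∀ t, ContinuousWithinAt f (Ici t) t
  left_limit : ∀ t, ∃ l : ℝ, Tendsto f (𝓝[<] t) (𝓝 l)

/-- The space `D([0, ∞))` of real càdlàg functions on `[0, ∞)`. -/
def SkorokhodSpace : Type := {f : ℝ≥0 → ℝ // IsCadlag f}

namespace SkorokhodSpace

instance : CoeFun SkorokhodSpace (fun _ => ℝ≥0 → ℝ) := ⟨Subtype.val⟩

/-- The basic Skorokhod (J1) neighbourhood of `x`: the paths `y` for which there is a time change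
`τ` (an increasing bijection of `[0, ∞)`, hence a homeomorphism fixing `0`) with
`|τ s - s| < ε` for all `s` and `|y (τ s) - x s| < ε` for all `s ≤ T`. -/
def basicNhd (x : SkorokhodSpace) (T : ℝ≥0) (ε : ℝ) : Set SkorokhodSpace :=
  {y | ∃ τ : ℝ≥0 ≃o ℝ≥0,
    (∀ s, |(τ s : ℝ) - (s : ℝ)| < ε) ∧ ∀ s ≤ T, |y (τ s) - x s| < ε}

theorem basicNhd_mono (x : SkorokhodSpace) {T T' : ℝ≥0} {ε ε' : ℝ} (hT : T' ≤ T) (hε : ε ≤ ε') :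
    basicNhd x T ε ⊆ basicNhd x T' ε' := by
  rintro y ⟨τ, h1, h2⟩
  exact ⟨τ, fun s => (h1 s).trans_le hε, fun s hs => (h2 s (hs.trans hT)).trans_le hε⟩

/-- The Skorokhod J1 topology on `D([0, ∞))`. It is the topology for which `yₙ → x` if and only if
there are time changes `τₙ` with `sup_s |τₙ s - s| → 0` and `sup_{s ≤ T} |yₙ (τₙ s) - x s| → 0`
for every `T`. -/
instance : TopologicalSpace SkorokhodSpace where
  IsOpen U := ∀ x ∈ U, ∃ (T : ℝ≥0) (ε : ℝ), 0 < ε ∧ basicNhd x T ε ⊆ U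
  isOpen_univ := fun _ _ => ⟨0, 1, one_pos, subset_univ _⟩
  isOpen_inter := by
    rintro U V hU hV x ⟨hxU, hxV⟩
    obtain ⟨T, ε, hε, h⟩ := hU x hxU
    obtain ⟨T', ε', hε', h'⟩ := hV x hxV
    exact ⟨max T T', min ε ε', lt_min hε hε', subset_inter
      ((basicNhd_mono x (le_max_left _ _) (min_le_left _ _)).trans h)
      ((basicNhd_mono x (le_max_right _ _) (min_le_right _ _)).trans h')⟩
  isOpen_sUnion := by
    rintro 𝒰 h𝒰 x ⟨U, hU, hxU⟩
    obtain ⟨T, ε, hε, h⟩ := h𝒰 U hU x hxU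
    exact ⟨T, ε, hε, h.trans (subset_sUnion_of_mem hU)⟩

/-- `D([0, ∞))` carries the Borel σ-algebra of the Skorokhod topology. -/
instance : MeasurableSpace SkorokhodSpace := borel SkorokhodSpace

instance : BorelSpace SkorokhodSpace := ⟨rfl⟩

end SkorokhodSpace

theorem isCadlag_floor (s : ℕ → ℝ) (n : ℕ) (c : ℝ) :
    IsCadlag (fun t : ℝ≥0 => s ⌊(n : ℝ≥0) * t⌋₊ / c) where
  right_continuous t := by
    have h : ∀ᶠ u in 𝓝[≥] t, ⌊(n : ℝ≥0) * u⌋₊ = ⌊(n : ℝ≥0) * t⌋₊ := by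
      have hc : Tendsto (fun u : ℝ≥0 => (n : ℝ≥0) * u) (𝓝[≥] t) (𝓝 ((n : ℝ≥0) * t)) :=
        (continuous_const.mul continuous_id).continuousAt.tendsto.mono_left nhdsWithin_le_nhds
      filter_upwards [hc.eventually_lt_const (Nat.lt_floor_add_one ((n : ℝ≥0) * t)),
        self_mem_nhdsWithin] with u hu hut
      refine (Nat.floor_eq_iff (zero_le)).2 ⟨(Nat.floor_le (zero_le)).trans ?_, hu⟩
      exact mul_le_mul_right hut _
    refine Tendsto.congr' ?_ tendsto_const_nhds
    filter_upwards [h] with u hu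
    rw [hu]
  left_limit t := by
    have hm : Monotone (fun u : ℝ≥0 => ⌊(n : ℝ≥0) * u⌋₊) := fun u v huv =>
      Nat.floor_mono (mul_le_mul_right huv _)
    have h := hm.tendsto_nhdsLT t
    exact ⟨_, ((continuous_of_discreteTopology (f := fun m : ℕ => s m / c)).tendsto _).comp h⟩

/-- `ξ` is Rademacher distributed with parameter `r`: it is `1` with probability `r` and `-1` with
probability `1 - r`. -/
def IsRademacher {Ω : Type*} [MeasurableSpace Ω] (P : Measure Ω) (ξ : Ω → ℝ) (r : ℝ) : Prop :=
  P.real {ω | ξ ω = 1} = r ∧ P.real {ω | ξ ω = -1} = 1 - r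

/-- `X` is (on the indices `n ≥ 1`) the sequence of steps of an amnesic elephant random walk with
memory parameter `p`, first step parameter `q` and amnesia parameter `β`; `A` and `B` are the
sequences of signs and of remembered times that drive it. The values of `X` at `0` and of `A`, `B`
at `0` and `1` play no role. -/
structure IsAERW {Ω : Type*} [MeasurableSpace Ω] (P : Measure Ω) (p q β : ℝ)
    (X : ℕ → Ω → ℝ) (A : ℕ → Ω → ℝ) (B : ℕ → Ω → ℕ) : Prop where
  measurable_step : ∀ n, Measurable (X n)
  measurable_sign : ∀ n, Measurable (A n)
  measurable_time : ∀ n, Measurable (B n)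
  /-- The first step is `1` with probability `q` and `-1` with probability `1 - q`. -/
  first_step : IsRademacher P (X 1) q
  /-- The walk repeats (`A = 1`) or reverses (`A = -1`) the step made at the remembered time. -/
  step : ∀ n ≥ 1, ∀ᵐ ω ∂P, X (n + 1) ω = A (n + 1) ω * X (B (n + 1) ω) ω
  sign_law : ∀ n ≥ 1, IsRademacher P (A (n + 1)) p
  /-- The amnesic law of the remembered time on `{1, …, n}`. -/
  time_law : ∀ n ≥ 1, ∀ k ∈ Finset.Icc 1 n, P.real {ω | B (n + 1) ω = k} =
    (β + 1) * Real.Gamma (k + β) * Real.Gamma n / (Real.Gamma k * Real.Gamma (n + β + 1))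
  /-- The sign and the remembered time are independent of each other and, jointly, of the steps
  made so far. -/
  indep_sign_time : ∀ n ≥ 1, IndepFun (A (n + 1)) (B (n + 1)) P
  indep_past : ∀ n ≥ 1, IndepFun (fun ω => (A (n + 1) ω, B (n + 1) ω))
    (fun ω (k : Finset.Icc 1 n) => X k ω) P

/-- The position after `n` steps, `S_n = X_1 + ⋯ + X_n`, with `S_0 = 0`. -/
def walk {Ω : Type*} (X : ℕ → Ω → ℝ) (n : ℕ) (ω : Ω) : ℝ := ∑ k ∈ Finset.Icc 1 n, X k ω

/-- The path `t ↦ S_⌊nt⌋ / n ^ γ`, as an element of `D([0, ∞))`. -/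
noncomputable def rescaledWalk {Ω : Type*} (X : ℕ → Ω → ℝ) (γ : ℝ) (n : ℕ) (ω : Ω) :
    SkorokhodSpace :=
  ⟨fun t => walk X ⌊(n : ℝ≥0) * t⌋₊ ω / (n : ℝ) ^ γ, isCadlag_floor (fun m => walk X m ω) n _⟩

/-- The exponent `a (β + 1) - β`, where `a = 2 p - 1`. -/
def superExponent (p β : ℝ) : ℝ := (2 * p - 1) * (β + 1) - β

/-! Write a = 2p - 1 and s = a(β + 1). The remembered time k has weight proportional to Γ(k +
β)/Γ(k), hence to ρ_β(k - 1), where ρ_c = `risingProd c`. The conditional mean of the next step is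
therefore a multiple of the weighted sum Y = Σ ρ_β(k) X_{k+1}, not of S
(`IsAERW.integral_step_mul`), and M_n = Y_n / ρ_s(n) is a martingale.

Its increments are at most 2/R_{n+1} in absolute value, where R = ρ_s/ρ_β grows like a constant
times n^(s - β) by Euler's limit for Γ. The superdiffusive condition says exactly that s - β > 1/2,
so the squared bounds are summable and M converges almost surely and in mean square. Summation by
parts (`walk_succ_eq`) writes S_{n+1} as R_n M_n plus a multiple of Σ (R_{k+1} - R_k) M_k. A
weighted Cesàro argument, run in ℝ for almost sure convergence and in L² for mean square
convergence, then gives L = K · lim M with K > 0.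

The functional limit is pathwise: convergence of S_n / n^(s - β) forces locally uniform convergence
of the rescaled paths, hence almost sure convergence in D. If L were constant, mean square
convergence would make every M_n that same constant up to the factor K, and M_0, M_1 alone then
force p = 1 and q ∈ {0, 1}. -/

/-! ### Rising products and their growth -/

/-- The product `∏ (1 + c / k)` over `1 ≤ k ≤ n`, that is `Γ(n + c + 1) / (n! Γ(c + 1))`. -/
noncomputable def risingProd (c : ℝ) (n : ℕ) : ℝ := ∏ k ∈ Finset.range n, (1 + c / (k + 1))

theorem risingProd_zero (c : ℝ) : risingProd c 0 = 1 := by simp [risingProd]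

theorem risingProd_succ (c : ℝ) (n : ℕ) :
    risingProd c (n + 1) = risingProd c n * (1 + c / (n + 1)) := Finset.prod_range_succ _ _

theorem risingProd_pos {c : ℝ} (hc : 0 ≤ c) (n : ℕ) : 0 < risingProd c n :=
  Finset.prod_pos fun _ _ => by positivity

theorem gamma_nat_add {c : ℝ} (hc : 0 ≤ c) (n : ℕ) :
    Real.Gamma (n + 1 + c) = risingProd c n * n.factorial * Real.Gamma (1 + c) := by
  induction n with
  | zero => simp [risingProd_zero]
  | succ n ih =>
    have h : ((n + 1 : ℕ) : ℝ) + 1 + c = (n + 1 + c) + 1 := by push_cast; ring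
    rw [h, Real.Gamma_add_one (by positivity), ih, risingProd_succ, Nat.factorial_succ]
    push_cast
    field_simp

/-- Both factors contain ∏ (c + 1 + j) over j ≤ n, which cancels. As `Real.GammaSeq` converges to Γ,
this fixes the growth of the rising products. -/
theorem risingProd_mul_gammaSeq {c : ℝ} (hc : 0 ≤ c) (n : ℕ) :
    risingProd c (n + 1) * Real.GammaSeq (c + 1) n = (n : ℝ) ^ (c + 1) / (n + 1) := by
  have h : ∀ n : ℕ, ∏ j ∈ Finset.range n, (c + 1 + j) = risingProd c n * n.factorial := by
    intro n
    induction n with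
    | zero => simp [risingProd_zero]
    | succ n ih =>
      rw [Finset.prod_range_succ, ih, risingProd_succ, Nat.factorial_succ]
      push_cast
      field_simp
      ring
  have h1 := (risingProd_pos hc (n + 1)).ne'
  have h2 : ((n.factorial : ℕ) : ℝ) ≠ 0 := by positivity
  rw [Real.GammaSeq, h, Nat.factorial_succ]
  push_cast
  field_simp

/-- The quotient of two rising products. -/
noncomputable def risingRatio (s b : ℝ) (n : ℕ) : ℝ := risingProd s n / risingProd b n

theorem risingRatio_pos {s b : ℝ} (hs : 0 ≤ s) (hb : 0 ≤ b) (n : ℕ) : 0 < risingRatio s b n :=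
  div_pos (risingProd_pos hs n) (risingProd_pos hb n)

theorem risingRatio_succ {s b : ℝ} (hb : 0 ≤ b) (n : ℕ) :
    risingRatio s b (n + 1) = risingRatio s b n * ((n + 1 + s) / (n + 1 + b)) := by
  have h1 := (risingProd_pos hb n).ne'
  have h2 : (n : ℝ) + 1 + b ≠ 0 := by positivity
  rw [risingRatio, risingRatio, risingProd_succ, risingProd_succ]
  field_simp

theorem monotone_risingRatio {s b : ℝ} (hb : 0 ≤ b) (hs : b ≤ s) :
    Monotone (risingRatio s b) := by
  refine monotone_nat_of_le_succ fun n => ?_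
  rw [risingRatio_succ hb]
  refine le_mul_of_one_le_right (risingRatio_pos (hb.trans hs) hb n).le ?_
  rw [one_le_div (by positivity)]
  linarith

/-- Divide the `Real.GammaSeq` identities for b and s. The factors `h1` and `h2` below correct the
shifts from n + 1 to n in the products and in the power. The power has base n + 1 because R_n
accompanies S_{n+1}. -/
theorem tendsto_risingRatio_div {s b : ℝ} (hs : 0 ≤ s) (hb : 0 ≤ b) :
    Tendsto (fun n : ℕ => risingRatio s b n / ((n : ℝ) + 1) ^ (s - b)) atTop
      (𝓝 (Real.Gamma (b + 1) / Real.Gamma (s + 1))) := by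
  have h0 : Tendsto (fun n : ℕ => Real.GammaSeq (b + 1) n / Real.GammaSeq (s + 1) n) atTop
      (𝓝 (Real.Gamma (b + 1) / Real.Gamma (s + 1))) :=
    (Real.GammaSeq_tendsto_Gamma _).div (Real.GammaSeq_tendsto_Gamma _)
      (Real.Gamma_pos_of_pos (by linarith)).ne'
  have h1 : Tendsto (fun n : ℕ => ((n : ℝ) + 1 + b) / ((n : ℝ) + 1 + s)) atTop (𝓝 1) := by
    have := tendsto_add_mul_div_add_mul_atTop_nhds (𝕜 := ℝ) (1 + b) (1 + s) 1 (d := 1) one_ne_zero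
    simp only [div_one] at this
    refine this.congr fun n => ?_
    congr 1 <;> ring
  have h2 : Tendsto (fun n : ℕ => ((n : ℝ) / ((n : ℝ) + 1)) ^ (s - b)) atTop (𝓝 1) := by
    have := (tendsto_natCast_div_add_atTop (𝕜 := ℝ) 1).rpow_const (p := s - b)
      (Or.inl one_ne_zero)
    simpa using this
  have h3 := (h0.mul h1).mul h2
  simp only [mul_one] at h3
  refine h3.congr' ?_
  filter_upwards [eventually_gt_atTop 0] with n hn
  have hn' : (0 : ℝ) < n := by exact_mod_cast hn
  have e1 := risingProd_mul_gammaSeq hs n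
  have e2 := risingProd_mul_gammaSeq hb n
  have p1 := risingProd_pos hs n
  have p2 := risingProd_pos hb n
  have q1 := risingProd_pos hs (n + 1)
  have q2 := risingProd_pos hb (n + 1)
  have g1 : Real.GammaSeq (s + 1) n = (n : ℝ) ^ s * n / (n + 1) / risingProd s (n + 1) := by
    rw [eq_div_iff q1.ne', mul_comm, e1, Real.rpow_add_one hn'.ne']
  have g2 : Real.GammaSeq (b + 1) n = (n : ℝ) ^ b * n / (n + 1) / risingProd b (n + 1) := by
    rw [eq_div_iff q2.ne', mul_comm, e2, Real.rpow_add_one hn'.ne']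
  have t1 : (0 : ℝ) < (n : ℝ) ^ s := by positivity
  have t2 : (0 : ℝ) < (n : ℝ) ^ b := by positivity
  have t3 : (n : ℝ) + 1 + b ≠ 0 := by positivity
  have t4 : (n : ℝ) + 1 + s ≠ 0 := by positivity
  rw [g1, g2, Real.div_rpow hn'.le (by positivity), Real.rpow_sub hn', risingRatio,
    risingProd_succ, risingProd_succ]
  field_simp

theorem tendsto_risingRatio_atTop {s b : ℝ} (hb : 0 ≤ b) (hs : b < s) :
    Tendsto (risingRatio s b) atTop atTop := by
  have h1 : Tendsto (fun n : ℕ => ((n : ℝ) + 1) ^ (s - b)) atTop atTop :=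
    (tendsto_rpow_atTop (sub_pos.2 hs)).comp
      (tendsto_atTop_add_const_right _ _ tendsto_natCast_atTop_atTop)
  have h2 := (tendsto_risingRatio_div (hb.trans hs.le) hb).pos_mul_atTop
    (div_pos (Real.Gamma_pos_of_pos (by linarith)) (Real.Gamma_pos_of_pos (by linarith))) h1
  refine h2.congr fun n => ?_
  have : (0 : ℝ) < ((n : ℝ) + 1) ^ (s - b) := by positivity
  field_simp

theorem summable_inv_risingRatio_sq {s b : ℝ} (hb : 0 ≤ b) (hs : 1 / 2 < s - b) :
    Summable fun n : ℕ => (risingRatio s b n)⁻¹ ^ 2 := by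
  have hκ : 0 < Real.Gamma (b + 1) / Real.Gamma (s + 1) :=
    div_pos (Real.Gamma_pos_of_pos (by linarith)) (Real.Gamma_pos_of_pos (by linarith))
  have h := ((tendsto_risingRatio_div (s := s) (by linarith) hb).inv₀ hκ.ne').pow 2
  have hs' : Summable fun n : ℕ => (((n : ℝ) + 1) ^ (s - b))⁻¹ ^ 2 := by
    have h1 : Summable fun n : ℕ => ((n : ℝ) ^ (2 * (s - b)))⁻¹ :=
      Real.summable_nat_rpow_inv.2 (by linarith)
    refine ((summable_nat_add_iff 1).2 h1).congr fun n => ?_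
    push_cast
    rw [inv_pow, ← Real.rpow_natCast, ← Real.rpow_mul (by positivity)]
    congr 2
    push_cast
    ring
  refine summable_of_isBigO_nat hs' (h.isBigO_one ℝ |>.mul (Asymptotics.isBigO_refl
    (fun n : ℕ => (((n : ℝ) + 1) ^ (s - b))⁻¹ ^ 2) atTop) |>.congr (fun n => ?_) fun n => ?_)
  · have : (0 : ℝ) < ((n : ℝ) + 1) ^ (s - b) := by positivity
    field_simp
  · simp

/-! ### Weighted Cesàro means -/

/-- Weighted Cesàro means of a convergent sequence, with weights the increments of a monotone
sequence that tends to infinity. -/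
theorem tendsto_weighted_cesaro {E : Type*} [NormedAddCommGroup E] [NormedSpace ℝ E] {m : ℕ → E}
    {e : E} (hm : Tendsto m atTop (𝓝 e)) {R : ℕ → ℝ} (hR : Monotone R)
    (hR' : Tendsto R atTop atTop) :
    Tendsto (fun n => (R n)⁻¹ • ∑ k ∈ Finset.range n, (R (k + 1) - R k) • m k) atTop (𝓝 e) := by
  have hsum : ∀ n, ∑ k ∈ Finset.range n, (R (k + 1) - R k) = R n - R 0 :=
    fun n => Finset.sum_range_sub R n
  have h1 : (fun k => (R (k + 1) - R k) • (m k - e)) =o[atTop] fun k => R (k + 1) - R k := by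
    have := (Asymptotics.isBigO_refl (fun k => R (k + 1) - R k) atTop).smul_isLittleO
      ((Asymptotics.isLittleO_one_iff ℝ).2 (tendsto_sub_nhds_zero_iff.2 hm))
    simpa using this
  -- Little-o passes to partial sums because the weights are nonnegative and their sum, which
  -- telescopes to R n - R 0, diverges.
  have h2 := h1.sum_range (fun k => sub_nonneg.2 (hR k.le_succ))
    (by simp only [hsum]; exact tendsto_atTop_add_const_right _ _ hR')
  simp only [hsum, smul_sub, Finset.sum_sub_distrib, ← Finset.sum_smul] at h2
  have h3 : (fun n => R n - R 0) =O[atTop] R :=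
    (Asymptotics.isBigO_refl _ _).sub
      (((Asymptotics.isLittleO_const_left (c := R 0)).2
        (Or.inr (tendsto_norm_atTop_atTop.comp hR'))).isBigO)
  have h4 := (Asymptotics.isBigO_refl (fun n => (R n)⁻¹) atTop).smul_isLittleO (h2.trans_isBigO h3)
  have h5 : Tendsto (fun n => (R n)⁻¹ * R n) atTop (𝓝 1) := by
    refine tendsto_const_nhds.congr' ?_
    filter_upwards [hR'.eventually_gt_atTop 0] with n hn
    rw [inv_mul_cancel₀ hn.ne']
  have h6 := (h4.trans_isBigO (h5.isBigO_one ℝ))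
  rw [Asymptotics.isLittleO_one_iff] at h6
  have h7 : Tendsto (fun n => ((R n)⁻¹ * R n - (R n)⁻¹ * R 0) • e) atTop (𝓝 e) := by
    have := ((h5.sub (hR'.inv_tendsto_atTop.mul_const (R 0))).smul_const e)
    simpa using this
  have h8 := h6.add h7
  rw [zero_add] at h8
  refine h8.congr fun n => ?_
  rw [smul_sub, smul_smul, mul_sub, sub_add_cancel]

/-! ### Paths in D([0, ∞)) and pathwise convergence -/

theorem IsCadlag.of_continuous {f : ℝ≥0 → ℝ} (hf : Continuous f) : IsCadlag f where
  right_continuous _ := hf.continuousWithinAt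
  left_limit t := ⟨f t, hf.continuousAt.tendsto.mono_left nhdsWithin_le_nhds⟩

namespace SkorokhodSpace

/-- Locally uniform convergence implies convergence in the Skorokhod topology. -/
theorem tendsto_of_locally_uniform {ι : Type*} {l : Filter ι} {y : ι → SkorokhodSpace}
    {x : SkorokhodSpace}
    (h : ∀ (T : ℝ≥0) (ε : ℝ), 0 < ε → ∀ᶠ i in l, ∀ t ≤ T, |y i t - x t| < ε) :
    Tendsto y l (𝓝 x) := by
  rw [tendsto_nhds]
  intro U hU hx
  obtain ⟨T, ε, hε, hsub⟩ := hU x hx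
  filter_upwards [h T ε hε] with i hi
  exact hsub ⟨OrderIso.refl _, fun s => by simpa using hε, fun s hs => hi s hs⟩

/-- The path `t ↦ s ⌊n t⌋ / c`. -/
noncomputable def floorPath (n : ℕ) (c : ℝ) (s : ℕ → ℝ) : SkorokhodSpace :=
  ⟨_, isCadlag_floor s n c⟩

/-- Up to time T only finitely many coordinates of s matter. This yields Borel measurability of the
rescaled walk, which factors through its sequence of positions. -/
theorem continuous_floorPath (n : ℕ) (c : ℝ) : Continuous (floorPath n c) := by
  rw [continuous_iff_continuousAt]
  intro s
  refine tendsto_of_locally_uniform fun T ε hε => ?_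
  have h : ∀ᶠ s' : ℕ → ℝ in 𝓝 s, ∀ m ∈ Finset.range (⌊(n : ℝ≥0) * T⌋₊ + 1),
      |s' m / c - s m / c| < ε := by
    rw [Finset.eventually_all]
    intro m _
    have : Tendsto (fun s' : ℕ → ℝ => |s' m / c - s m / c|) (𝓝 s) (𝓝 |s m / c - s m / c|) :=
      Continuous.tendsto (by fun_prop) s
    rw [sub_self, abs_zero] at this
    exact this.eventually_lt_const hε
  filter_upwards [h] with s' hs' t ht
  exact hs' _ (Finset.mem_range_succ_iff.2 (Nat.floor_mono (mul_le_mul_right ht _)))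

/-- The path `t ↦ t ^ γ * l`. -/
noncomputable def powerPath (γ : ℝ) (hγ : 0 ≤ γ) (l : ℝ) : SkorokhodSpace :=
  ⟨fun t => (t : ℝ) ^ γ * l, IsCadlag.of_continuous
    (((Real.continuous_rpow_const hγ).comp NNReal.continuous_coe).mul continuous_const)⟩

theorem continuous_powerPath (γ : ℝ) (hγ : 0 ≤ γ) : Continuous (powerPath γ hγ) := by
  rw [continuous_iff_continuousAt]
  intro l
  refine tendsto_of_locally_uniform fun T ε hε => ?_
  have h : Tendsto (fun l' : ℝ => (T : ℝ) ^ γ * |l' - l|) (𝓝 l) (𝓝 ((T : ℝ) ^ γ * |l - l|)) :=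
    Continuous.tendsto (by fun_prop) l
  rw [sub_self, abs_zero, mul_zero] at h
  filter_upwards [h.eventually_lt_const hε] with l' hl' t ht
  refine lt_of_le_of_lt ?_ hl'
  change |(t : ℝ) ^ γ * l' - (t : ℝ) ^ γ * l| ≤ _
  rw [← mul_sub, abs_mul, abs_of_nonneg (by positivity)]
  gcongr

end SkorokhodSpace

/-- Subadditivity of x ↦ x^γ for exponents in [0, 1]. -/
theorem Real.abs_rpow_sub_rpow_le {γ : ℝ} (h0 : 0 ≤ γ) (h1 : γ ≤ 1) {x y : ℝ} (hx : 0 ≤ x)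
    (hxy : x ≤ y) : |x ^ γ - y ^ γ| ≤ (y - x) ^ γ := by
  rw [abs_sub_comm, abs_of_nonneg (sub_nonneg.2 (Real.rpow_le_rpow hx hxy h0)), sub_le_iff_le_add]
  have := Real.rpow_add_le_add_rpow (sub_nonneg.2 hxy) hx h0 h1
  rwa [sub_add_cancel] at this

/-- If `v n / n ^ γ` converges, the rescaled paths `v ⌊n t⌋ / n ^ γ` converge to `t ^ γ * l`,
uniformly on compact sets. -/
theorem eventually_rescaled_close {v : ℕ → ℝ} {γ l : ℝ} (h0 : 0 < γ) (h1 : γ ≤ 1) (hv0 : v 0 = 0)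
    (hv : Tendsto (fun n : ℕ => v n / (n : ℝ) ^ γ) atTop (𝓝 l)) (T : ℝ≥0) {ε : ℝ} (hε : 0 < ε) :
    ∀ᶠ n : ℕ in atTop, ∀ t ≤ T,
      |v ⌊(n : ℝ≥0) * t⌋₊ / (n : ℝ) ^ γ - (t : ℝ) ^ γ * l| < ε := by
  set e : ℕ → ℝ := fun m => v m / (m : ℝ) ^ γ - l with he
  have hve : ∀ m : ℕ, v m = (m : ℝ) ^ γ * (l + e m) := by
    intro m
    rcases Nat.eq_zero_or_pos m with rfl | hm
    · simp [hv0, Real.zero_rpow h0.ne']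
    · have : (0 : ℝ) < (m : ℝ) ^ γ := by positivity
      simp only [he]
      field_simp
      ring
  have hlim : Tendsto e atTop (𝓝 0) := tendsto_sub_nhds_zero_iff.2 hv
  -- The added 1 makes the denominator positive for every T and still gives T^γ δ ≤ ε / 3.
  set δ : ℝ := ε / 3 / ((T : ℝ) ^ γ + 1) with hδ
  have hT : 0 ≤ (T : ℝ) ^ γ := by positivity
  have hδ0 : 0 < δ := by positivity
  obtain ⟨N, hN⟩ := eventually_atTop.1 (hlim.abs.eventually_lt_const (by simpa using hδ0))
  obtain ⟨C, hC⟩ := hlim.abs.bddAbove_range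
  have hC' : ∀ m, |e m| ≤ C := fun m => hC ⟨m, rfl⟩
  have hC0 : 0 ≤ C := (abs_nonneg _).trans (hC' 0)
  have hpow : Tendsto (fun n : ℕ => (n : ℝ) ^ γ) atTop atTop :=
    (tendsto_rpow_atTop h0).comp tendsto_natCast_atTop_atTop
  have c1 : Tendsto (fun n : ℕ => (N : ℝ) ^ γ * C / (n : ℝ) ^ γ) atTop (𝓝 0) :=
    hpow.const_div_atTop _
  have c2 : Tendsto (fun n : ℕ => |l| / (n : ℝ) ^ γ) atTop (𝓝 0) := hpow.const_div_atTop _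
  filter_upwards [c1.eventually_lt_const (show 0 < ε / 3 by positivity),
    c2.eventually_lt_const (show 0 < ε / 3 by positivity), eventually_gt_atTop 0] with n b1 b2 hn t ht
  have hn' : (0 : ℝ) < n := by exact_mod_cast hn
  have hnγ : (0 : ℝ) < (n : ℝ) ^ γ := by positivity
  set m := ⌊(n : ℝ≥0) * t⌋₊ with hm
  have hmle : (m : ℝ) ≤ n * t := by
    have := Nat.floor_le (zero_le : 0 ≤ (n : ℝ≥0) * t)
    exact_mod_cast this
  have hmlt : (n : ℝ) * t < m + 1 := by
    have := Nat.lt_floor_add_one ((n : ℝ≥0) * t)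
    exact_mod_cast this
  have htT : (t : ℝ) ≤ T := by exact_mod_cast ht
  have hx : (m : ℝ) / n ≤ t := by rw [div_le_iff₀ hn']; linarith
  have hdec : v m / (n : ℝ) ^ γ - (t : ℝ) ^ γ * l
      = ((m : ℝ) / n) ^ γ * e m + (((m : ℝ) / n) ^ γ - (t : ℝ) ^ γ) * l := by
    rw [hve, Real.div_rpow (by positivity) hn'.le]
    field_simp
    ring
  have B1 : |((m : ℝ) / n) ^ γ * e m| < ε / 3 + ε / 3 := by
    rw [abs_mul, abs_of_nonneg (by positivity : 0 ≤ ((m : ℝ) / n) ^ γ)]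
    -- For m ≥ N the error e m is small and (m/n)^γ ≤ T^γ. For m < N the error is only bounded, but
    -- (m/n)^γ ≤ (N/n)^γ tends to 0.
    by_cases hmN : N ≤ m
    · have k1 : ((m : ℝ) / n) ^ γ ≤ (T : ℝ) ^ γ := Real.rpow_le_rpow (by positivity) (hx.trans htT) h0.le
      have k2 := (hN m hmN).le
      have k3 : (T : ℝ) ^ γ * δ ≤ ε / 3 := by
        rw [hδ, mul_div_assoc', div_le_iff₀ (by positivity)]
        nlinarith
      have := mul_le_mul k1 k2 (abs_nonneg _) hT
      linarith
    · have k1 : ((m : ℝ) / n) ^ γ ≤ (N : ℝ) ^ γ / (n : ℝ) ^ γ := by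
        rw [Real.div_rpow (by positivity) hn'.le]
        gcongr
        exact (not_le.1 hmN).le
      have := mul_le_mul k1 (hC' m) (abs_nonneg _) (by positivity)
      rw [div_mul_eq_mul_div] at this
      linarith
  have B2 : |(((m : ℝ) / n) ^ γ - (t : ℝ) ^ γ) * l| < ε / 3 := by
    rw [abs_mul]
    have k1 := Real.abs_rpow_sub_rpow_le h0.le h1 (by positivity) hx
    -- Taking the floor moves the time by at most 1/n.
    have k2 : ((t : ℝ) - m / n) ^ γ ≤ (1 / (n : ℝ)) ^ γ := by
      refine Real.rpow_le_rpow (sub_nonneg.2 hx) ?_ h0.le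
      rw [sub_le_iff_le_add, ← add_div, le_div_iff₀ hn']
      linarith
    rw [Real.div_rpow zero_le_one hn'.le, Real.one_rpow] at k2
    refine lt_of_le_of_lt (mul_le_mul_of_nonneg_right (k1.trans k2) (abs_nonneg l)) ?_
    rwa [div_mul_eq_mul_div, one_mul]
  rw [hdec]
  refine (abs_add_le _ _).trans_lt ?_
  linarith

/-! ### Square-integrable martingales -/

theorem MeasureTheory.MemLp.eLpNorm_two_eq {Ω : Type*} {m0 : MeasurableSpace Ω} {P : Measure Ω}
    {f : Ω → ℝ} (hf : MemLp f 2 P) : eLpNorm f 2 P = ENNReal.ofReal (√(∫ ω, f ω ^ 2 ∂P)) := by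
  rw [hf.eLpNorm_eq_integral_rpow_norm (by norm_num) (by norm_num), Real.sqrt_eq_rpow]
  simp

namespace MeasureTheory

variable {Ω : Type*} {m0 : MeasurableSpace Ω} {P : Measure Ω} [IsProbabilityMeasure P]
  {F : Filtration ℕ m0} {f : ℕ → Ω → ℝ}

/-- Conditioning on F n pulls out the first factor, and the second has conditional mean zero. -/
theorem Martingale.integral_increment_mul_eq_zero (hf : Martingale f F P)
    (hL : ∀ n, MemLp (f n) 2 P) {m n : ℕ} (hmn : m ≤ n) :
    ∫ ω, (f n ω - f m ω) * (f (n + 1) ω - f n ω) ∂P = 0 := by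
  have hs : StronglyMeasurable[F n] (f n - f m) :=
    (hf.stronglyMeasurable n).sub ((hf.stronglyMeasurable m).mono (F.mono hmn))
  have hi : Integrable ((f n - f m) * (f (n + 1) - f n)) P :=
    ((hL n).sub (hL m)).integrable_mul ((hL (n + 1)).sub (hL n))
  have h1 : P[(f n - f m) * (f (n + 1) - f n) | F n] =ᵐ[P] 0 := by
    refine (condExp_mul_of_stronglyMeasurable_left hs hi
      ((hf.integrable _).sub (hf.integrable _))).trans ?_
    have h2 := condExp_sub (hf.integrable (n + 1)) (hf.integrable n) (F n)
    have h3 := hf.condExp_ae_eq n.le_succ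
    have h4 := hf.condExp_ae_eq (le_refl n)
    filter_upwards [h2, h3, h4] with ω e2 e3 e4
    simp only [Nat.succ_eq_add_one] at e3
    simp [e2, e3, e4]
  have h5 := integral_condExp (μ := P) (F.le n) (f := (f n - f m) * (f (n + 1) - f n))
  rw [integral_congr_ae h1] at h5
  simpa using h5.symm

/-- Expand the square one increment at a time; the cross terms vanish by orthogonality. -/
theorem Martingale.integral_sq_sub_le (hf : Martingale f F P) (hL : ∀ n, MemLp (f n) 2 P)
    {d : ℕ → ℝ} (hd : ∀ n, ∫ ω, (f (n + 1) ω - f n ω) ^ 2 ∂P ≤ d n) (m k : ℕ) :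
    ∫ ω, (f (m + k) ω - f m ω) ^ 2 ∂P ≤ ∑ i ∈ Finset.range k, d (m + i) := by
  induction k with
  | zero => simp
  | succ k ih =>
    rw [Finset.sum_range_succ]
    have i1 : Integrable (fun ω => (f (m + k) ω - f m ω) ^ 2) P :=
      ((hL (m + k)).sub (hL m)).integrable_sq
    have i2 : Integrable (fun ω => (f (m + k + 1) ω - f (m + k) ω) ^ 2) P :=
      ((hL (m + k + 1)).sub (hL (m + k))).integrable_sq
    have i3 : Integrable (fun ω => (f (m + k) ω - f m ω) * (f (m + k + 1) ω - f (m + k) ω)) P :=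
      ((hL (m + k)).sub (hL m)).integrable_mul ((hL (m + k + 1)).sub (hL (m + k)))
    have i4 : Integrable (fun ω => (f (m + k) ω - f m ω) ^ 2 +
        2 * ((f (m + k) ω - f m ω) * (f (m + k + 1) ω - f (m + k) ω))) P := i1.add (i3.const_mul 2)
    have e : ∀ ω, (f (m + (k + 1)) ω - f m ω) ^ 2 = (f (m + k) ω - f m ω) ^ 2 +
        2 * ((f (m + k) ω - f m ω) * (f (m + k + 1) ω - f (m + k) ω)) +
        (f (m + k + 1) ω - f (m + k) ω) ^ 2 := by
      intro ω
      rw [← add_assoc]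
      ring
    simp only [e]
    rw [integral_add i4 i2, integral_add i1 (i3.const_mul 2),
      integral_const_mul, hf.integral_increment_mul_eq_zero hL (Nat.le_add_right m k)]
    linarith [hd (m + k)]

/-- A martingale whose increments have summable second moments converges almost surely and in
mean square. -/
theorem Martingale.exists_tendsto_of_summable_sq (hf : Martingale f F P)
    (hL : ∀ n, MemLp (f n) 2 P) {d : ℕ → ℝ}
    (hd : ∀ n, ∫ ω, (f (n + 1) ω - f n ω) ^ 2 ∂P ≤ d n) (hs : Summable d) :
    ∃ g : Ω → ℝ, Measurable g ∧ MemLp g 2 P ∧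
      (∀ᵐ ω ∂P, Tendsto (fun n => f n ω) atTop (𝓝 (g ω))) ∧
      Tendsto (fun n => eLpNorm (f n - g) 2 P) atTop (𝓝 0) := by
  have hd0 : ∀ n, 0 ≤ d n := fun n => (integral_nonneg fun _ => sq_nonneg _).trans (hd n)
  set τ : ℕ → ℝ := fun m => ∑' i, d (i + m) with hτ
  have hτ0 : Tendsto τ atTop (𝓝 0) := tendsto_sum_nat_add d
  have hsub : ∀ m n, m ≤ n → eLpNorm (f n - f m) 2 P ≤ ENNReal.ofReal (√(τ m)) := by
    intro m n hmn
    obtain ⟨k, rfl⟩ := Nat.exists_eq_add_of_le hmn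
    rw [((hL _).sub (hL _)).eLpNorm_two_eq]
    refine ENNReal.ofReal_le_ofReal (Real.sqrt_le_sqrt
      ((hf.integral_sq_sub_le hL hd m k).trans ?_))
    simp only [hτ, add_comm m]
    exact ((summable_nat_add_iff m).2 hs).sum_le_tsum _ fun i _ => hd0 _
  obtain ⟨K, hK⟩ : ∃ K : ℝ≥0, ∀ n, eLpNorm (f n) 2 P ≤ K := by
    refine ⟨(ENNReal.ofReal (√(τ 0)) + eLpNorm (f 0) 2 P).toNNReal, fun n => ?_⟩
    rw [ENNReal.coe_toNNReal (ENNReal.add_ne_top.2 ⟨ENNReal.ofReal_ne_top, (hL 0).eLpNorm_ne_top⟩)]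
    calc eLpNorm (f n) 2 P = eLpNorm (f n - f 0 + f 0) 2 P := by rw [sub_add_cancel]
      _ ≤ eLpNorm (f n - f 0) 2 P + eLpNorm (f 0) 2 P :=
        eLpNorm_add_le ((hL n).sub (hL 0)).1 (hL 0).1 (by norm_num)
      _ ≤ _ := by gcongr; exact hsub 0 n (Nat.zero_le n)
  have hK1 : ∀ n, eLpNorm (f n) 1 P ≤ K := fun n =>
    (eLpNorm_le_eLpNorm_of_exponent_le (by norm_num) (hL n).1).trans (hK n)
  obtain ⟨g, hgm, hg2, hae⟩ : ∃ g : Ω → ℝ, Measurable g ∧ MemLp g 2 P ∧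
      ∀ᵐ ω ∂P, Tendsto (fun n => f n ω) atTop (𝓝 (g ω)) :=
    ⟨_, Filtration.stronglyMeasurable_limit_process'.measurable,
      hf.submartingale.memLp_limitProcess hK, hf.submartingale.ae_tendsto_limitProcess hK1⟩
  refine ⟨g, hgm, hg2, hae, ?_⟩
  -- Fatou: the bound on f n - f m is uniform in n ≥ m, so it survives the limit n → ∞.
  have hle : ∀ m, eLpNorm (f m - g) 2 P ≤ ENNReal.ofReal (√(τ m)) := by
    intro m
    rw [eLpNorm_sub_comm]
    refine (Lp.eLpNorm_lim_le_liminf_eLpNorm (f := fun n => f n - f m)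
      (fun n => ((hL n).sub (hL m)).1) _ ?_).trans ?_
    · filter_upwards [hae] with ω hω
      exact hω.sub_const _
    · refine liminf_le_of_frequently_le' (Eventually.frequently ?_)
      filter_upwards [eventually_ge_atTop m] with n hn
      exact hsub m n hn
  have h0 : Tendsto (fun m => ENNReal.ofReal (√(τ m))) atTop (𝓝 0) := by
    have := ENNReal.tendsto_ofReal hτ0.sqrt
    simpa using this
  exact tendsto_of_tendsto_of_tendsto_of_le_of_le tendsto_const_nhds h0 (fun _ => zero_le) hle

/-- A martingale that converges in mean square to a constant is constant. -/
theorem Martingale.ae_eq_const_of_tendsto (hf : Martingale f F P) (hL : ∀ n, MemLp (f n) 2 P)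
    {g : Ω → ℝ} (hg : MemLp g 2 P)
    (hlim : Tendsto (fun n => eLpNorm (f n - g) 2 P) atTop (𝓝 0)) {c : ℝ}
    (hc : ∀ᵐ ω ∂P, g ω = c) (n : ℕ) : ∀ᵐ ω ∂P, f n ω = c := by
  have h1 : Tendsto (fun n => eLpNorm (f n - g) 1 P) atTop (𝓝 0) :=
    tendsto_of_tendsto_of_tendsto_of_le_of_le tendsto_const_nhds hlim (fun _ => zero_le)
      fun n => eLpNorm_le_eLpNorm_of_exponent_le (by norm_num) ((hL n).sub hg).1
  -- Convergence in L¹ closes the martingale: f n is the conditional expectation of g.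
  have h2 := hf.eq_condExp_of_tendsto_eLpNorm (hg.integrable (by norm_num)) h1 n
  have h3 : P[g | F n] =ᵐ[P] P[fun _ => c | F n] := condExp_congr_ae hc
  rw [condExp_const (F.le n)] at h3
  exact h2.trans h3

end MeasureTheory

/-! ### Total memory weight and Rademacher variables -/

/-- Telescoping, since (k + 1) ρ(k + 1) - k ρ(k) = (b + 1) ρ(k). It gives the memory law total mass
1 and bounds the weighted walk. -/
theorem mul_sum_risingProd {b : ℝ} (n : ℕ) :
    (b + 1) * ∑ k ∈ Finset.range n, risingProd b k = n * risingProd b n := by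
  induction n with
  | zero => simp
  | succ n ih =>
    rw [Finset.sum_range_succ, mul_add, ih, risingProd_succ]
    push_cast
    field_simp
    ring

theorem ae_mem_of_measureReal_eq_one {Ω : Type*} [MeasurableSpace Ω] {P : Measure Ω}
    [IsProbabilityMeasure P] {s : Set Ω} (hs : MeasurableSet s) (h : P.real s = 1) :
    ∀ᵐ ω ∂P, ω ∈ s :=
  (mem_ae_iff_prob_eq_one hs).2 ((ENNReal.toReal_eq_one_iff _).1 h)

section Rademacher

variable {Ω : Type*} [MeasurableSpace Ω] {P : Measure Ω} [IsProbabilityMeasure P] {ξ : Ω → ℝ}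
  {r : ℝ}

theorem IsRademacher.ae_eq_or (h : IsRademacher P ξ r) (hξ : Measurable ξ) :
    ∀ᵐ ω ∂P, ξ ω = 1 ∨ ξ ω = -1 := by
  have hd : Disjoint {ω | ξ ω = 1} {ω | ξ ω = -1} := by
    rw [Set.disjoint_left]
    intro ω h1 h2
    rw [mem_ofPred_eq] at h1 h2
    linarith
  have hm : MeasurableSet {ω | ξ ω = -1} := hξ (measurableSet_singleton _)
  have h1 : P.real ({ω | ξ ω = 1} ∪ {ω | ξ ω = -1}) = 1 := by
    rw [measureReal_union hd hm, h.1, h.2]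
    ring
  exact ae_mem_of_measureReal_eq_one ((hξ (measurableSet_singleton (1 : ℝ))).union hm) h1

theorem IsRademacher.integral_eq (h : IsRademacher P ξ r) (hξ : Measurable ξ) :
    ∫ ω, ξ ω ∂P = 2 * r - 1 := by
  have m1 : MeasurableSet {ω | ξ ω = 1} := hξ (measurableSet_singleton _)
  have m2 : MeasurableSet {ω | ξ ω = -1} := hξ (measurableSet_singleton _)
  have e : ξ =ᵐ[P] fun ω => {ω | ξ ω = 1}.indicator (1 : Ω → ℝ) ω -
      {ω | ξ ω = -1}.indicator (1 : Ω → ℝ) ω := by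
    filter_upwards [h.ae_eq_or hξ] with ω hω
    rcases hω with hω | hω
    · simp [indicator, hω]
      norm_num
    · simp [indicator, hω]
      norm_num
  rw [integral_congr_ae e, integral_sub ((integrable_const 1).indicator m1)
    ((integrable_const 1).indicator m2), integral_indicator_one m1, integral_indicator_one m2,
    h.1, h.2]
  ring

end Rademacher

/-! ### Pathwise identities for the walk and the martingale -/

section Walk

variable {Ω : Type*}

/-- The weighted sum `∑ μ_k X_k` of the first `n + 1` steps, with `μ_{k+1} = ∏_{j ≤ k} (1 + b / j)`. -/
noncomputable def weightedWalk (b : ℝ) (X : ℕ → Ω → ℝ) (n : ℕ) (ω : Ω) : ℝ :=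
  ∑ k ∈ Finset.range (n + 1), risingProd b k * X (k + 1) ω

/-- The normalized weighted sum of the steps, a martingale when `s` is the mean of the signs
times `b + 1`. -/
noncomputable def walkMartingale (s b : ℝ) (X : ℕ → Ω → ℝ) (n : ℕ) (ω : Ω) : ℝ :=
  weightedWalk b X n ω / risingProd s n

theorem weightedWalk_zero (b : ℝ) (X : ℕ → Ω → ℝ) (ω : Ω) : weightedWalk b X 0 ω = X 1 ω := by
  simp [weightedWalk, risingProd_zero]

theorem weightedWalk_succ (b : ℝ) (X : ℕ → Ω → ℝ) (n : ℕ) (ω : Ω) :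
    weightedWalk b X (n + 1) ω = weightedWalk b X n ω + risingProd b (n + 1) * X (n + 2) ω :=
  Finset.sum_range_succ _ _

theorem abs_weightedWalk_le {b : ℝ} (hb : 0 ≤ b) {X : ℕ → Ω → ℝ} {ω : Ω}
    (hX : ∀ k, |X (k + 1) ω| ≤ 1) (n : ℕ) :
    (b + 1) * |weightedWalk b X n ω| ≤ (n + 1) * risingProd b (n + 1) := by
  have := mul_sum_risingProd (b := b) (n + 1)
  push_cast at this
  rw [← this]
  refine mul_le_mul_of_nonneg_left ?_ (by linarith)
  refine (Finset.abs_sum_le_sum_abs _ _).trans (Finset.sum_le_sum fun k _ => ?_)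
  rw [abs_mul, abs_of_pos (risingProd_pos hb k)]
  exact mul_le_of_le_one_right (risingProd_pos hb k).le (hX k)

/-- In the AERW case, with s = (2p - 1)(b + 1), the subtracted term is the conditional mean of the
step, so an increment is a centred step divided by R_{n+1}. -/
theorem walkMartingale_succ_sub {s b : ℝ} (hs : 0 ≤ s) (hb : 0 ≤ b) (X : ℕ → Ω → ℝ) (n : ℕ)
    (ω : Ω) : walkMartingale s b X (n + 1) ω - walkMartingale s b X n ω =
      (risingRatio s b (n + 1))⁻¹ *
        (X (n + 2) ω - s / ((n + 1) * risingProd b (n + 1)) * weightedWalk b X n ω) := by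
  have h1 := risingProd_pos hs n
  have h2 := risingProd_pos hb (n + 1)
  have h3 : (n : ℝ) + 1 + s ≠ 0 := by positivity
  rw [walkMartingale, walkMartingale, weightedWalk_succ, risingRatio, risingProd_succ s]
  field_simp
  ring

/-- Summation by parts: the walk in terms of the martingale. -/
theorem walk_succ_eq {s b : ℝ} (hb : 0 ≤ b) (hs : b < s) (X : ℕ → Ω → ℝ) (n : ℕ) (ω : Ω) :
    walk X (n + 1) ω = risingRatio s b n * walkMartingale s b X n ω + b / (s - b) *
      ∑ k ∈ Finset.range n,
        (risingRatio s b (k + 1) - risingRatio s b k) * walkMartingale s b X k ω := by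
  induction n with
  | zero => simp [walk, risingRatio, walkMartingale, weightedWalk_zero, risingProd_zero]
  | succ n ih =>
    have h0 : 0 ≤ s := hb.trans hs.le
    have e : walk X (n + 1 + 1) ω = walk X (n + 1) ω + X (n + 2) ω :=
      Finset.sum_Icc_succ_top (by omega) _
    have h1 := risingProd_pos h0 n
    have h2 := risingProd_pos hb n
    have h3 : (n : ℝ) + 1 + s ≠ 0 := by positivity
    have h4 : (n : ℝ) + 1 + b ≠ 0 := by positivity
    have h5 : s - b ≠ 0 := (sub_pos.2 hs).ne'
    -- The inductive step rests on R_{k+1} - R_k = R_k (s - b)/(k + 1 + b); the factor b/(s - b)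
    -- turns this into R_k b/(k + 1 + b), the loss when Y_k is divided by ρ_b(k + 1) instead of
    -- ρ_b(k).
    rw [e, ih, Finset.sum_range_succ, walkMartingale, walkMartingale, weightedWalk_succ,
      risingRatio_succ hb, risingProd_succ, risingProd_succ, risingRatio]
    field_simp
    ring

end Walk

/-! ### Conditional mean of a step and the martingale property -/

/-- The filtration whose `n`-th σ-algebra is generated by the first `n + 1` steps. -/
def stepFiltration {Ω : Type*} [mΩ : MeasurableSpace Ω] (X : ℕ → Ω → ℝ)
    (hX : ∀ n, Measurable (X n)) : Filtration ℕ mΩ where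
  seq n := MeasurableSpace.comap (fun ω (k : Finset.Icc 1 (n + 1)) => X k ω) inferInstance
  mono' m n hmn := by
    have hsub : Finset.Icc 1 (m + 1) ⊆ Finset.Icc 1 (n + 1) :=
      Finset.Icc_subset_Icc_right (by omega)
    have h : Measurable fun (x : Finset.Icc 1 (n + 1) → ℝ) (k : Finset.Icc 1 (m + 1)) =>
      x ⟨k, hsub k.2⟩ := measurable_pi_lambda _ fun k => measurable_pi_apply _
    exact (h.comp (comap_measurable fun ω (k : Finset.Icc 1 (n + 1)) => X k ω)).comap_le
  le' n := Measurable.comap_le (measurable_pi_lambda _ fun k => hX k.1)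

theorem measurable_stepFiltration {Ω : Type*} [MeasurableSpace Ω] {X : ℕ → Ω → ℝ}
    (hX : ∀ n, Measurable (X n)) {k n : ℕ} (hkn : k ≤ n) :
    Measurable[stepFiltration X hX n] (X (k + 1)) := by
  have hk : k + 1 ∈ Finset.Icc 1 (n + 1) := Finset.mem_Icc.2 (by omega)
  exact (measurable_pi_apply (⟨k + 1, hk⟩ : Finset.Icc 1 (n + 1))).comp
    (comap_measurable fun ω (k : Finset.Icc 1 (n + 1)) => X k ω)

namespace IsAERW

variable {Ω : Type*} [MeasurableSpace Ω] {P : Measure Ω} {p q β : ℝ}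
  {X A : ℕ → Ω → ℝ} {B : ℕ → Ω → ℕ}

theorem time_law_risingProd (hX : IsAERW P p q β X A B) (hβ : 0 ≤ β) {k n : ℕ} (hkn : k ≤ n) :
    P.real {ω | B (n + 2) ω = k + 1} =
      (β + 1) * risingProd β k / ((n + 1) * risingProd β (n + 1)) := by
  have h := hX.time_law (n + 1) (by omega) (k + 1) (Finset.mem_Icc.2 (by omega))
  rw [h]
  have e1 : ((k + 1 : ℕ) : ℝ) + β = k + 1 + β := by push_cast; ring
  have e2 : ((n + 1 : ℕ) : ℝ) + β + 1 = ((n + 1 : ℕ) : ℝ) + 1 + β := by ring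
  rw [e1, e2, gamma_nat_add hβ, gamma_nat_add hβ, Nat.cast_add_one, Nat.cast_add_one,
    Real.Gamma_nat_eq_factorial, Real.Gamma_nat_eq_factorial, Nat.factorial_succ]
  have h1 := risingProd_pos hβ (n + 1)
  have h2 : 0 < Real.Gamma (1 + β) := Real.Gamma_pos_of_pos (by linarith)
  have h3 : (k.factorial : ℝ) ≠ 0 := by positivity
  have h4 : (n.factorial : ℝ) ≠ 0 := by positivity
  push_cast
  field_simp

variable [IsProbabilityMeasure P]

theorem ae_time_mem (hX : IsAERW P p q β X A B) (hβ : 0 ≤ β) (n : ℕ) :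
    ∀ᵐ ω ∂P, ∃ k ≤ n, B (n + 2) ω = k + 1 := by
  have hm : ∀ k, MeasurableSet {ω | B (n + 2) ω = k + 1} := fun k =>
    hX.measurable_time (n + 2) (measurableSet_singleton _)
  have h1 : P.real (⋃ k ∈ Finset.range (n + 1), {ω | B (n + 2) ω = k + 1}) = 1 := by
    rw [measureReal_biUnion_finset _ fun k _ => hm k]
    · rw [Finset.sum_congr rfl fun k hk =>
        hX.time_law_risingProd hβ (Finset.mem_range_succ_iff.1 hk), ← Finset.sum_div,
        ← Finset.mul_sum, mul_sum_risingProd]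
      push_cast
      exact div_self (mul_pos (by positivity) (risingProd_pos hβ _)).ne'
    · intro i _ j _ hij
      refine Set.disjoint_left.2 fun ω h h' => hij ?_
      rw [mem_ofPred_eq] at h h'
      omega
  filter_upwards [ae_mem_of_measureReal_eq_one (Finset.measurableSet_biUnion _ fun k _ => hm k) h1]
    with ω hω
  simpa [Nat.lt_succ_iff] using hω

/-- Strong induction: each step is a sign times a step at a strictly earlier remembered time. -/
theorem ae_step_eq_or (hX : IsAERW P p q β X A B) (hβ : 0 ≤ β) :
    ∀ᵐ ω ∂P, ∀ n, X (n + 1) ω = 1 ∨ X (n + 1) ω = -1 := by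
  have h1 := hX.first_step.ae_eq_or (hX.measurable_step 1)
  have h2 : ∀ᵐ ω ∂P, ∀ n, X (n + 2) ω = A (n + 2) ω * X (B (n + 2) ω) ω :=
    ae_all_iff.2 fun n => hX.step (n + 1) (by omega)
  have h3 : ∀ᵐ ω ∂P, ∀ n, A (n + 2) ω = 1 ∨ A (n + 2) ω = -1 :=
    ae_all_iff.2 fun n => (hX.sign_law (n + 1) (by omega)).ae_eq_or (hX.measurable_sign _)
  filter_upwards [h1, h2, h3, ae_all_iff.2 (hX.ae_time_mem hβ)] with ω h1 h2 h3 h4 n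
  induction n using Nat.strong_induction_on with
  | _ n ih =>
    rcases n with _ | n
    · exact h1
    · obtain ⟨k, hk, hB⟩ := h4 n
      have e := h2 n
      rw [hB] at e
      change X (n + 2) ω = 1 ∨ X (n + 2) ω = -1
      rw [e]
      rcases h3 n with h | h <;> rcases ih k (by omega) with h' | h' <;> simp [h, h']

theorem ae_abs_step_le (hX : IsAERW P p q β X A B) (hβ : 0 ≤ β) :
    ∀ᵐ ω ∂P, ∀ n, |X (n + 1) ω| ≤ 1 := by
  filter_upwards [hX.ae_step_eq_or hβ] with ω hω n
  rcases hω n with h | h <;> simp [h]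

/-- The conditional mean of a step given the past, tested against a bounded function of it. -/
theorem integral_step_mul (hX : IsAERW P p q β X A B) (hβ : 0 ≤ β) (n : ℕ) {g : Ω → ℝ}
    (hg : Measurable[stepFiltration X hX.measurable_step n] g) {C : ℝ} (hC : ∀ ω, |g ω| ≤ C) :
    ∫ ω, X (n + 2) ω * g ω ∂P = ∫ ω, ((2 * p - 1) * (β + 1) / ((n + 1) * risingProd β (n + 1)) *
      weightedWalk β X n ω) * g ω ∂P := by
  set F := stepFiltration X hX.measurable_step
  have hg' : Measurable g := hg.mono (F.le n) le_rfl
  have hA := hX.sign_law (n + 1) (by omega)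
  have mA := hX.measurable_sign (n + 2)
  have mB := hX.measurable_time (n + 2)
  set φ : ℕ → ℕ → ℝ := fun k b => if b = k + 1 then 1 else 0 with hφ
  have mφ : ∀ k, Measurable (φ k) := fun k => measurable_of_countable _
  have hφ1 : ∀ k b, |φ k b| ≤ 1 := by
    intro k b
    simp only [hφ]
    split_ifs <;> simp
  -- Split according to the remembered time, so that each term is a function of the new sign and
  -- time multiplied by a function of the past.
  have hdec : ∀ᵐ ω ∂P, X (n + 2) ω * g ω = ∑ k ∈ Finset.range (n + 1),
      (A (n + 2) ω * φ k (B (n + 2) ω)) * (X (k + 1) ω * g ω) := by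
    filter_upwards [hX.step (n + 1) (by omega), hX.ae_time_mem hβ n] with ω h1 ⟨j, hj, hB⟩
    rw [show n + 2 = n + 1 + 1 from rfl, h1, show n + 1 + 1 = n + 2 from rfl, hB,
      Finset.sum_eq_single j]
    · simp [hφ]
      ring
    · intro k _ hk
      simp [hφ, hk.symm]
    · intro hj'
      exact absurd (Finset.mem_range_succ_iff.2 hj) hj'
  have hXg : ∀ k, Integrable (fun ω => X (k + 1) ω * g ω) P := by
    intro k
    refine Integrable.of_bound (((hX.measurable_step _).mul hg').aestronglyMeasurable) C ?_
    filter_upwards [hX.ae_abs_step_le hβ] with ω hω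
    rw [Real.norm_eq_abs, abs_mul]
    exact (mul_le_of_le_one_left (abs_nonneg _) (hω k)).trans (hC ω)
  have hterm : ∀ k ≤ n, ∫ ω, (A (n + 2) ω * φ k (B (n + 2) ω)) * (X (k + 1) ω * g ω) ∂P =
      (2 * p - 1) * ((β + 1) * risingProd β k / ((n + 1) * risingProd β (n + 1))) *
        ∫ ω, X (k + 1) ω * g ω ∂P := by
    intro k hk
    have hi : IndepFun (fun ω => A (n + 2) ω * φ k (B (n + 2) ω)) (fun ω => X (k + 1) ω * g ω) P := by
      have h1 := (hX.indep_past (n + 1) (by omega)).comp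
        (φ := fun x : ℝ × ℕ => x.1 * φ k x.2) (ψ := id)
        (measurable_fst.mul ((mφ k).comp measurable_snd)) measurable_id
      rw [IndepFun_iff_Indep] at h1 ⊢
      exact indep_of_indep_of_le_right h1
        ((measurable_stepFiltration hX.measurable_step hk).mul hg).comap_le
    rw [hi.integral_fun_mul_eq_mul_integral (mA.mul ((mφ k).comp mB)).aestronglyMeasurable
      (hXg k).1]
    have hi' := (hX.indep_sign_time (n + 1) (by omega)).comp measurable_id (mφ k)
    have e1 : ∫ ω, A (n + 2) ω * φ k (B (n + 2) ω) ∂P =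
        (∫ ω, A (n + 2) ω ∂P) * ∫ ω, φ k (B (n + 2) ω) ∂P :=
      hi'.integral_fun_mul_eq_mul_integral mA.aestronglyMeasurable
        ((mφ k).comp mB).aestronglyMeasurable
    have e2 : ∫ ω, φ k (B (n + 2) ω) ∂P = P.real {ω | B (n + 2) ω = k + 1} := by
      have e : (fun ω => φ k (B (n + 2) ω)) = {ω | B (n + 2) ω = k + 1}.indicator 1 := by
        ext ω
        simp [hφ, indicator]
      rw [e]
      exact integral_indicator_one (mB (measurableSet_singleton (k + 1)))
    rw [e1, hA.integral_eq mA, e2, hX.time_law_risingProd hβ hk]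
  have hint : ∀ k ∈ Finset.range (n + 1),
      Integrable (fun ω => (A (n + 2) ω * φ k (B (n + 2) ω)) * (X (k + 1) ω * g ω)) P := by
    intro k _
    refine (hXg k).bdd_mul (c := 1) (mA.mul ((mφ k).comp mB)).aestronglyMeasurable ?_
    filter_upwards [hA.ae_eq_or mA] with ω hω
    rw [Real.norm_eq_abs, abs_mul]
    refine mul_le_one₀ ?_ (abs_nonneg _) (hφ1 _ _)
    rcases hω with h | h
    · exact (congrArg abs h).trans_le (by simp)
    · exact (congrArg abs h).trans_le (by simp)
  rw [integral_congr_ae hdec, integral_finsetSum _ hint,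
    Finset.sum_congr rfl fun k hk => hterm k (Finset.mem_range_succ_iff.1 hk)]
  have e : ∀ ω, (2 * p - 1) * (β + 1) / ((n + 1) * risingProd β (n + 1)) *
      weightedWalk β X n ω * g ω = ∑ k ∈ Finset.range (n + 1),
      (2 * p - 1) * ((β + 1) * risingProd β k / ((n + 1) * risingProd β (n + 1))) *
        (X (k + 1) ω * g ω) := by
    intro ω
    rw [weightedWalk, Finset.mul_sum, Finset.sum_mul]
    refine Finset.sum_congr rfl fun k _ => ?_
    ring
  simp only [e]
  rw [integral_finsetSum _ fun k _ => (hXg k).const_mul _]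
  exact Finset.sum_congr rfl fun k _ => (integral_const_mul _ _).symm

end IsAERW

namespace IsAERW

variable {Ω : Type*} [MeasurableSpace Ω] {P : Measure Ω} {p q β : ℝ}
  {X A : ℕ → Ω → ℝ} {B : ℕ → Ω → ℕ}

theorem measurable_weightedWalk (hX : IsAERW P p q β X A B) (n : ℕ) :
    Measurable[stepFiltration X hX.measurable_step n] (weightedWalk β X n) :=
  Finset.measurable_fun_sum _ fun _ hk => Measurable.const_mul
    (measurable_stepFiltration hX.measurable_step (Finset.mem_range_succ_iff.1 hk)) _

variable [IsProbabilityMeasure P]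

theorem memLp_walk (hX : IsAERW P p q β X A B) (hβ : 0 ≤ β) (n : ℕ) : MemLp (walk X n) 2 P := by
  refine memLp_finsetSum _ fun k hk => ?_
  obtain ⟨j, rfl⟩ := Nat.exists_eq_add_of_le' (Finset.mem_Icc.1 hk).1
  exact MemLp.of_bound (hX.measurable_step _).aestronglyMeasurable 1
    ((hX.ae_abs_step_le hβ).mono fun ω hω => hω j)

theorem memLp_weightedWalk (hX : IsAERW P p q β X A B) (hβ : 0 ≤ β) (n : ℕ) :
    MemLp (weightedWalk β X n) 2 P := by
  refine MemLp.of_bound ((hX.measurable_weightedWalk n).mono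
    ((stepFiltration X hX.measurable_step).le n) le_rfl).aestronglyMeasurable
    ((n + 1) * risingProd β (n + 1)) ?_
  filter_upwards [hX.ae_abs_step_le hβ] with ω hω
  refine le_trans ?_ (abs_weightedWalk_le hβ hω n)
  exact le_mul_of_one_le_left (abs_nonneg _) (by linarith)

theorem memLp_walkMartingale (hX : IsAERW P p q β X A B) (hβ : 0 ≤ β) (s : ℝ) (n : ℕ) :
    MemLp (walkMartingale s β X n) 2 P := by
  have := (hX.memLp_weightedWalk hβ n).const_mul (risingProd s n)⁻¹
  refine this.ae_eq (Eventually.of_forall fun ω => ?_)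
  rw [walkMartingale, div_eq_inv_mul]

/-- Test the increment on events of F n: the conditional mean formula, applied to indicators, makes
its integral vanish. -/
theorem martingale_walkMartingale (hX : IsAERW P p q β X A B) (hβ : 0 ≤ β)
    (hs : 0 ≤ (2 * p - 1) * (β + 1)) :
    Martingale (walkMartingale ((2 * p - 1) * (β + 1)) β X)
      (stepFiltration X hX.measurable_step) P := by
  set F := stepFiltration X hX.measurable_step
  set s := (2 * p - 1) * (β + 1) with hs_def
  have hm : ∀ n, Measurable[F n] (walkMartingale s β X n) := fun n =>
    (hX.measurable_weightedWalk n).div_const _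
  have hint : ∀ n, Integrable (walkMartingale s β X n) P := fun n =>
    (hX.memLp_walkMartingale hβ s n).integrable (by norm_num)
  refine martingale_nat (fun n => (hm n).stronglyMeasurable) hint fun n => ?_
  refine ae_eq_condExp_of_forall_setIntegral_eq (F.le n) (hint (n + 1))
    (fun t _ _ => (hint n).integrableOn) (fun t ht _ => ?_)
    (hm n).stronglyMeasurable.aestronglyMeasurable
  have hg : Measurable[F n] (t.indicator (1 : Ω → ℝ)) :=
    Measurable.indicator (@measurable_const _ _ _ (F n) 1) ht
  have hg1 : ∀ ω, |t.indicator (1 : Ω → ℝ) ω| ≤ 1 := by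
    intro ω
    by_cases h : ω ∈ t <;> simp [h]
  have ht' : MeasurableSet t := F.le n t ht
  have key := hX.integral_step_mul hβ n hg hg1
  have i1 : Integrable (X (n + 2)) P := by
    refine Integrable.of_bound (hX.measurable_step _).aestronglyMeasurable 1 ?_
    filter_upwards [hX.ae_abs_step_le hβ] with ω hω
    exact hω (n + 1)
  have i2 : Integrable (fun ω => s / ((n + 1) * risingProd β (n + 1)) * weightedWalk β X n ω) P :=
    ((hX.memLp_weightedWalk hβ n).integrable (by norm_num)).const_mul _
  have hset : ∀ f : Ω → ℝ, ∫ ω, f ω * t.indicator (1 : Ω → ℝ) ω ∂P = ∫ ω in t, f ω ∂P := by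
    intro f
    rw [← integral_indicator ht']
    congr 1
    ext ω
    by_cases h : ω ∈ t <;> simp [h]
  rw [hset, hset] at key
  have h0 : ∫ ω in t, (walkMartingale s β X (n + 1) ω - walkMartingale s β X n ω) ∂P = 0 := by
    simp only [walkMartingale_succ_sub hs hβ]
    rw [integral_const_mul, integral_sub i1.integrableOn i2.integrableOn, key, sub_self, mul_zero]
  rw [integral_sub (hint _).integrableOn (hint _).integrableOn] at h0
  linarith

/-- The step and its conditional mean both lie in [-1, 1], the latter because s ≤ β + 1. Their
difference is at most 2 in absolute value, whence the 4. -/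
theorem integral_sq_increment_le (hX : IsAERW P p q β X A B) (hβ : 0 ≤ β) (hp : p ≤ 1)
    (hs : 0 ≤ (2 * p - 1) * (β + 1)) (n : ℕ) :
    ∫ ω, (walkMartingale ((2 * p - 1) * (β + 1)) β X (n + 1) ω -
      walkMartingale ((2 * p - 1) * (β + 1)) β X n ω) ^ 2 ∂P ≤
      4 * (risingRatio ((2 * p - 1) * (β + 1)) β (n + 1))⁻¹ ^ 2 := by
  set s := (2 * p - 1) * (β + 1) with hs_def
  have hi := ((hX.memLp_walkMartingale hβ s (n + 1)).sub
    (hX.memLp_walkMartingale hβ s n)).integrable_sq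
  calc _ ≤ ∫ _, 4 * (risingRatio s β (n + 1))⁻¹ ^ 2 ∂P := by
        refine integral_mono_ae hi (integrable_const _) ?_
        filter_upwards [hX.ae_abs_step_le hβ] with ω hω
        have h1 := abs_weightedWalk_le hβ hω n
        have h2 := risingProd_pos hβ (n + 1)
        have h3 : |s / ((n + 1) * risingProd β (n + 1)) * weightedWalk β X n ω| ≤ 1 := by
          have hsle : s ≤ β + 1 := by
            rw [hs_def]
            nlinarith
          rw [abs_mul, abs_of_nonneg (by positivity), div_mul_eq_mul_div,
            div_le_one (by positivity)]
          exact (mul_le_mul_of_nonneg_right hsle (abs_nonneg _)).trans h1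
        have h4 := abs_le.1 h3
        have h5 := abs_le.1 (hω (n + 1))
        change (walkMartingale s β X (n + 1) ω - walkMartingale s β X n ω) ^ 2 ≤ _
        rw [walkMartingale_succ_sub hs hβ, mul_pow, mul_comm]
        refine mul_le_mul_of_nonneg_right ?_ (sq_nonneg _)
        rw [show (4 : ℝ) = 2 ^ 2 by norm_num, sq_le_sq, abs_of_pos (two_pos : (0 : ℝ) < 2), abs_le]
        constructor <;> linarith [h5.1, h5.2]
    _ = _ := by simp

/-- The only walks whose martingale limit is constant are the deterministic ones. -/
theorem deterministic_of_martingale_const (hX : IsAERW P p q β X A B) (hβ : 0 ≤ β)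
    (hs : 0 < (2 * p - 1) * (β + 1)) {c : ℝ}
    (hc : ∀ n, ∀ᵐ ω ∂P, walkMartingale ((2 * p - 1) * (β + 1)) β X n ω = c) :
    p = 1 ∧ (q = 0 ∨ q = 1) := by
  set s := (2 * p - 1) * (β + 1) with hs_def
  have hM0 : ∀ ω, walkMartingale s β X 0 ω = X 1 ω := fun ω => by
    simp [walkMartingale, weightedWalk_zero, risingProd_zero]
  have hq : 2 * q - 1 = c := by
    rw [← hX.first_step.integral_eq (hX.measurable_step 1)]
    have h : X 1 =ᵐ[P] fun _ => c := (hc 0).mono fun ω hω => (hM0 ω).symm.trans hω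
    rw [integral_congr_ae h]
    simp
  -- A single generic ω suffices: M_0 = M_1 there forces X_2 = (2p - 1) X_1 with both steps ±1. As
  -- 2p - 1 > 0, this gives p = 1, while 2q - 1 = X_1 = ±1 decides q.
  obtain ⟨ω, h0, h1, hω⟩ := ((hc 0).and ((hc 1).and (hX.ae_step_eq_or hβ))).exists
  have hx1 : X 1 ω = c := (hM0 ω).symm.trans h0
  have h2 := walkMartingale_succ_sub hs.le hβ X 0 ω
  rw [h0, h1, sub_self, weightedWalk_zero, risingProd_succ, risingProd_zero] at h2
  have h3 := (mul_eq_zero.1 h2.symm).resolve_left (inv_pos.2 (risingRatio_pos hs.le hβ _)).ne'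
  have h4 : s / (((0 : ℕ) + 1) * (1 * (1 + β / ((0 : ℕ) + 1)))) = 2 * p - 1 := by
    rw [hs_def]
    have : 1 + β ≠ 0 := by positivity
    simp
    field_simp
    ring
  rw [h4, zero_add] at h3
  have hp0 : 0 < 2 * p - 1 := pos_of_mul_pos_left hs (by linarith)
  have a1 : X 1 ω = 1 ∨ X 1 ω = -1 := hω 0
  have a2 : X 2 ω = 1 ∨ X 2 ω = -1 := hω 1
  constructor
  · rcases a1 with e1 | e1 <;> rcases a2 with e2 | e2 <;> rw [e1, e2] at h3 <;> linarith
  · rcases a1 with e1 | e1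
    · right
      linarith
    · left
      linarith

end IsAERW

/-! ### From the martingale limit to the limit of the walk -/

/-- Convergence of the normalized summation-by-parts expression of `walk_succ_eq`. -/
theorem tendsto_summation_by_parts {E : Type*} [NormedAddCommGroup E] [NormedSpace ℝ E]
    {m : ℕ → E} {e : E} (hm : Tendsto m atTop (𝓝 e)) {s b : ℝ} (hb : 0 ≤ b) (hs : b < s) :
    Tendsto (fun n : ℕ => (((n : ℝ) + 1) ^ (s - b))⁻¹ • (risingRatio s b n • m n +
      (b / (s - b)) • ∑ k ∈ Finset.range n, (risingRatio s b (k + 1) - risingRatio s b k) • m k))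
      atTop (𝓝 ((Real.Gamma (b + 1) / Real.Gamma (s + 1) * (1 + b / (s - b))) • e)) := by
  have h1 := tendsto_weighted_cesaro hm (monotone_risingRatio hb hs.le)
    (tendsto_risingRatio_atTop hb hs)
  have h2 := (tendsto_risingRatio_div (hb.trans hs.le) hb).smul (hm.add (h1.const_smul (b / (s - b))))
  have h3 : (Real.Gamma (b + 1) / Real.Gamma (s + 1) * (1 + b / (s - b))) • e =
      (Real.Gamma (b + 1) / Real.Gamma (s + 1)) • (e + (b / (s - b)) • e) := by
    rw [mul_smul, add_smul, one_smul]
  rw [h3]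
  refine h2.congr fun n => ?_
  have hR := (risingRatio_pos (hb.trans hs.le) hb n).ne'
  rw [div_eq_inv_mul, mul_smul]
  congr 1
  rw [smul_add, smul_comm (risingRatio s b n) (b / (s - b)), smul_smul (risingRatio s b n),
    mul_inv_cancel₀ hR, one_smul]

/-- The mean square version of `tendsto_summation_by_parts`. -/
theorem tendsto_eLpNorm_summation_by_parts {Ω : Type*} [MeasurableSpace Ω] {P : Measure Ω}
    {m : ℕ → Ω → ℝ} (hm : ∀ n, MemLp (m n) 2 P) {g : Ω → ℝ} (hg : MemLp g 2 P)
    (h : Tendsto (fun n => eLpNorm (m n - g) 2 P) atTop (𝓝 0)) {s b : ℝ} (hb : 0 ≤ b)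
    (hs : b < s) :
    Tendsto (fun n : ℕ => eLpNorm (fun ω => (((n : ℝ) + 1) ^ (s - b))⁻¹ *
      (risingRatio s b n * m n ω + b / (s - b) *
        ∑ k ∈ Finset.range n, (risingRatio s b (k + 1) - risingRatio s b k) * m k ω) -
      Real.Gamma (b + 1) / Real.Gamma (s + 1) * (1 + b / (s - b)) * g ω) 2 P) atTop (𝓝 0) := by
  set K := Real.Gamma (b + 1) / Real.Gamma (s + 1) * (1 + b / (s - b)) with hK
  set u : ℕ → Lp ℝ 2 P := fun n => (hm n).toLp with hu
  set r : ℕ → ℝ := fun k => risingRatio s b (k + 1) - risingRatio s b k with hr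
  -- The summation-by-parts limit holds in any normed space, so it applies in `Lp ℝ 2 P`; the rest
  -- translates between classes and functions.
  have h1 : Tendsto u atTop (𝓝 hg.toLp) := (Lp.tendsto_Lp_iff_tendsto_eLpNorm'' _ hm _ hg).2 h
  have h2 := tendsto_summation_by_parts h1 hb hs
  rw [← MemLp.toLp_const_smul] at h2
  refine ((Lp.tendsto_Lp_iff_tendsto_eLpNorm _ _ (hg.const_smul K)).1 h2).congr fun n => ?_
  refine eLpNorm_congr_ae ?_
  have hu' : ∀ k, u k =ᵐ[P] m k := fun k => (hm k).coeFn_toLp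
  have hsum : ∀ᵐ ω ∂P, ∀ k, (r k • u k : Lp ℝ 2 P) ω = r k * m k ω := by
    refine ae_all_iff.2 fun k => ?_
    filter_upwards [Lp.coeFn_smul (r k) (u k), hu' k] with ω e1 e2
    rw [e1, Pi.smul_apply, e2, smul_eq_mul]
  filter_upwards [hsum, Lp.coeFn_smul (((n : ℝ) + 1) ^ (s - b))⁻¹ (risingRatio s b n • u n +
      (b / (s - b)) • ∑ k ∈ Finset.range n, r k • u k),
    Lp.coeFn_add (risingRatio s b n • u n) ((b / (s - b)) • ∑ k ∈ Finset.range n, r k • u k),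
    Lp.coeFn_smul (risingRatio s b n) (u n), hu' n,
    Lp.coeFn_smul (b / (s - b)) (∑ k ∈ Finset.range n, r k • u k),
    Lp.coeFn_fun_finsetSum (Finset.range n) fun k => r k • u k] with ω e1 e2 e3 e4 e5 e6 e7
  rw [Pi.sub_apply, e2, Pi.smul_apply, e3, Pi.add_apply, e4, Pi.smul_apply, e5, e6, Pi.smul_apply,
    e7, Finset.sum_congr rfl fun k _ => e1 k]
  rfl

/-! ### The main theorem -/

theorem theorem2p7 {Ω : Type*} [MeasurableSpace Ω] (P : Measure Ω) [IsProbabilityMeasure P]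
    (p q β : ℝ) (hp : p ∈ Icc (0 : ℝ) 1) (hq : q ∈ Icc (0 : ℝ) 1) (hβ : 0 ≤ β)
    (hsuper : (4 * β + 3) / (4 * (β + 1)) < p)
    (X : ℕ → Ω → ℝ) (A : ℕ → Ω → ℝ) (B : ℕ → Ω → ℕ) (hX : IsAERW P p q β X A B) :
    ∃ L : Ω → ℝ, Measurable L ∧ MemLp L 2 P ∧
      -- `L` is non-degenerate, unless the whole walk is deterministic
      (¬ (p = 1 ∧ (q = 0 ∨ q = 1)) → ∀ c : ℝ, ¬ (∀ᵐ ω ∂P, L ω = c)) ∧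
      -- almost sure convergence
      (∀ᵐ ω ∂P, Tendsto (fun n : ℕ => walk X n ω / (n : ℝ) ^ superExponent p β)
        atTop (𝓝 (L ω))) ∧
      -- mean square convergence
      Tendsto (fun n : ℕ => ∫ ω, |walk X n ω / (n : ℝ) ^ superExponent p β - L ω| ^ 2 ∂P)
        atTop (𝓝 0) ∧
      -- convergence in distribution in `D([0, ∞))`
      ∃ Λ : Ω → SkorokhodSpace,
        (∀ ω (t : ℝ≥0), Λ ω t = (t : ℝ) ^ superExponent p β * L ω) ∧
        TendstoInDistribution (fun n : ℕ => rescaledWalk X (superExponent p β) n) atTop Λ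
          (fun _ => P) P := by
  set s := (2 * p - 1) * (β + 1) with hs_def
  have hγ_def : superExponent p β = s - β := rfl
  rw [hγ_def]
  -- The superdiffusive condition, rewritten as the summability threshold for 1/R_n².
  have hγ : 1 / 2 < s - β := by
    rw [div_lt_iff₀ (by positivity)] at hsuper
    rw [hs_def]
    linarith
  have hγ1 : s - β ≤ 1 := by
    rw [hs_def]
    nlinarith [hp.2]
  have hs0 : 0 < s := by linarith
  have hsβ : β < s := by linarith
  have hM : Martingale (walkMartingale s β X) _ P := hX.martingale_walkMartingale hβ hs0.le
  have hL2 := hX.memLp_walkMartingale hβ s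
  obtain ⟨g, hgm, hg2, hgae, hgL⟩ := hM.exists_tendsto_of_summable_sq hL2
    (hX.integral_sq_increment_le hβ hp.2 hs0.le)
    (((summable_nat_add_iff 1).2 (summable_inv_risingRatio_sq hβ hγ)).mul_left 4)
  set K := Real.Gamma (β + 1) / Real.Gamma (s + 1) * (1 + β / (s - β)) with hK
  have hKpos : 0 < K := by
    have h1 := Real.Gamma_pos_of_pos (show 0 < β + 1 by linarith)
    have h2 := Real.Gamma_pos_of_pos (show 0 < s + 1 by linarith)
    have h3 : 0 < s - β := by linarith
    positivity
  have hae : ∀ᵐ ω ∂P, Tendsto (fun n : ℕ => walk X n ω / (n : ℝ) ^ (s - β)) atTop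
      (𝓝 (K * g ω)) := by
    filter_upwards [hgae] with ω hω
    -- The summation by parts expresses S_{n+1} through M_0, …, M_n.
    rw [← tendsto_add_atTop_iff_nat 1]
    refine (tendsto_summation_by_parts hω hβ hsβ).congr fun n => ?_
    simp only [smul_eq_mul]
    rw [walk_succ_eq hβ hsβ, Nat.cast_add_one, ← div_eq_inv_mul]
  have mwalk : ∀ n, Measurable (walk X n) := fun n =>
    Finset.measurable_fun_sum _ fun k _ => hX.measurable_step k
  have hLmem : MemLp (fun ω => K * g ω) 2 P := hg2.const_mul K
  refine ⟨fun ω => K * g ω, hgm.const_mul K, hLmem, ?_, hae, ?_, ?_⟩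
  · intro hnd c hc
    refine hnd (hX.deterministic_of_martingale_const hβ hs0 (c := c / K)
      (hM.ae_eq_const_of_tendsto hL2 hg2 hgL ?_))
    filter_upwards [hc] with ω hω
    rw [eq_div_iff hKpos.ne', mul_comm, hω]
  · rw [← tendsto_add_atTop_iff_nat 1]
    have h1 := tendsto_eLpNorm_summation_by_parts hL2 hg2 hgL hβ hsβ
    have hmem : ∀ n : ℕ, MemLp (fun ω => walk X n ω / (n : ℝ) ^ (s - β) - K * g ω) 2 P := fun n =>
      MemLp.sub (by simpa only [div_eq_inv_mul] using (hX.memLp_walk hβ n).const_mul _) hLmem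
    have h2 : Tendsto (fun n : ℕ => eLpNorm
        (fun ω => walk X (n + 1) ω / ((n + 1 : ℕ) : ℝ) ^ (s - β) - K * g ω) 2 P) atTop (𝓝 0) := by
      refine h1.congr fun n => congrArg (fun f => eLpNorm f 2 P) (funext fun ω => ?_)
      rw [walk_succ_eq hβ hsβ, Nat.cast_add_one, ← div_eq_inv_mul]
    have h3 := ((ENNReal.tendsto_toReal ENNReal.zero_ne_top).comp h2).pow 2
    simp only [ENNReal.toReal_zero, ne_eq, OfNat.ofNat_ne_zero, not_false_eq_true, zero_pow] at h3
    refine h3.congr fun n => ?_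
    simp only [Function.comp_apply, sq_abs]
    rw [(hmem (n + 1)).eLpNorm_two_eq, ENNReal.toReal_ofReal (Real.sqrt_nonneg _),
      Real.sq_sqrt (integral_nonneg fun _ => sq_nonneg _)]
  · refine ⟨fun ω => SkorokhodSpace.powerPath (s - β) (by linarith) (K * g ω), fun _ _ => rfl, ?_⟩
    -- Almost sure convergence in D suffices, since the limit lives on the same probability space.
    refine tendstoInDistribution_of_ae_tendsto (fun n => Measurable.aemeasurable ?_)
      (Measurable.aemeasurable ?_) ?_
    · exact (SkorokhodSpace.continuous_floorPath n ((n : ℝ) ^ (s - β))).measurable.comp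
        (measurable_pi_lambda (fun ω m => walk X m ω) mwalk)
    · exact (SkorokhodSpace.continuous_powerPath _ _).measurable.comp (hgm.const_mul K)
    · filter_upwards [hae] with ω hω
      exact SkorokhodSpace.tendsto_of_locally_uniform fun T ε hε =>
        eventually_rescaled_close (by linarith) hγ1 (by simp [walk]) hω T hε
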